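/- Let $G$ be a connected simple graph (finite or infinite) with vertex set $V$ and shortest-path distance $d=d_G$. Definitions. For $v\in V$ and $r\in\mathbb N$ let $D_G(v,r)=\{u\in V: d(u,v)\le r\}$. $G$ is *$a$-weakly-Helly* ($a\in\mathbb N$) if for every $S\subseteq V$ and $r:S\to\mathbb N$ such that the disks $D_G(v,r(v))$, $v\in S$, pairwise intersect, $\bigcap_{v\in S}D_G(v,r(v)+a)\ne\emptyset$; the *Helly-gap* $\alpha(G)$ is the least such $a$. The *interval thinness* $\kappa(G)$ is the least $\kappa\in\mathbb N$ such that $d(u,v)\le\kappa$ for all $x,y\in V$, all $0\le \ell\le d(x,y)$ and all $u,v$ in the slice $S_\ell(x,y)=\{w: d(x,w)+d(w,y)=d(x,y),\ d(x,w)=\ell\}$. $G$ is *$\delta$-hyperbolic* ($\delta\ge 0$ real) if for any four vertices $u,v,w,x$ the two larger of the sums $d(u,v)+d(w,x)$, $d(u,w)+d(v,x)$, $d(u,x)+d(v,w)$ differ by at most $2\delta$; the *hyperbolicity* $\delta(G)$ is the least such $\delta$. Each of $\alpha(G),\kappa(G),\delta(G)$ is $\infty$ if no such number exists (never the case if $G$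 is finite). The *injective hull* $\mathcal H(G)$ is the graph whose vertices are the functions $f:V\to\mathbb N$ such that $f(x)+f(y)\ge d(x,y)$ for all $x,y\in V$ and for every $x\in V$ there is $y\in V$ with $f(x)+f(y)=d(x,y)$; two such $f,g$ are adjacent iff $\max_{x\in V}|f(x)-g(x)|=1$. A vertex $z\in V$ is identified with the vertex $d_z=d(z,\cdot)$ of $\mathcal H(G)$. $G$ is *$k$-chordal* if it has no induced cycle of length greater than $k$. Three distinct pairwise non-adjacent vertices form an *asteroidal triple* if every two of them are connected by a path that avoids the neighborhood of the third; $G$ is *AT-free* if it has no asteroidal triple. Statement. Put $H=\mathcal H(G)$. Then $H$ is connected, and: 1. for every vertex $h$ of $H$ there is $v\in V$ with $d_H(h,v)\le\kappa(H)$; 2. $\alpha(G)\le\kappa(H)$; 3. $\kappa(G)\le 2\delta(G)$ and $\kappa(H)\le2\delta(H)$; 4. $\delta(H)=\delta(G)$; 5. $\alpha(G)\le 2\delta(G)$; thus, if $G$ is $\delta$-hyperbolic for a real $\delta\ge0$, then $G$ is $\lfloor 2\delta\rfloor$-weakly-Helly and $\alpha(G)\le 2\delta$; 6. for every $k\in\mathbb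 N$, if $G$ is $k$-chordal, then $\alpha(G)\le\lfloor k/2\rfloor$; 7. if $G$ is AT-free, then $\alpha(G)\le 2$. -/

import Mathlib

open scoped NNReal ENNReal

namespace HellyGap

variable {V : Type*}

/-- The disk `D_G(v, r)`. -/
def disk (G : SimpleGraph V) (v : V) (r : ℕ) : Set V :=
  {u | G.dist u v ≤ r}

/-- `G` is `a`-weakly-Helly: every system of pairwise intersecting disks gets a common vertex once
all the radii are increased by `a`. -/
def IsWeaklyHelly (G : SimpleGraph V) (a : ℕ) : Prop :=
  ∀ (S : Set V) (r : V → ℕ),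
    (∀ u ∈ S, ∀ v ∈ S, (disk G u (r u) ∩ disk G v (r v)).Nonempty) →
      (⋂ v ∈ S, disk G v (r v + a)).Nonempty

/-- The Helly-gap `α(G)`: the least `a` for which `G` is `a`-weakly-Helly
(`⊤` if there is none, which can happen only for infinite graphs). -/
noncomputable def hellyGap (G : SimpleGraph V) : ℕ∞ :=
  ⨅ a ∈ {a : ℕ | IsWeaklyHelly G a}, (a : ℕ∞)

/-- The interval `I(x, y)`. -/
def interval (G : SimpleGraph V) (x y : V) : Set V :=
  {u | G.dist x u + G.dist u y = G.dist x y}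

/-- The interval slice `S_l(x, y)`. -/
def slice (G : SimpleGraph V) (x y : V) (l : ℕ) : Set V :=
  {u | u ∈ interval G x y ∧ G.dist x u = l}

/-- The interval `I(x, y)` is `t`-thin. -/
def IsThinInterval (G : SimpleGraph V) (x y : V) (t : ℕ) : Prop :=
  ∀ l ≤ G.dist x y, ∀ u ∈ slice G x y l, ∀ v ∈ slice G x y l, G.dist u v ≤ t

/-- The interval thinness `κ(G)`: the least `t` for which all intervals are `t`-thin
(`⊤` if there is none, which can happen only for infinite graphs). -/
noncomputable def intervalThinness (G : SimpleGraph V) : ℕ∞ :=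
  ⨅ t ∈ {t : ℕ | ∀ x y, IsThinInterval G x y t}, (t : ℕ∞)

/-- Gromov's four-point condition. Since the four vertices range over all ordered quadruples, the
inequality says that the two larger ones of the three distance sums differ by at most `2 * δ`. -/
def IsHyperbolic (G : SimpleGraph V) (δ : ℝ≥0) : Prop :=
  ∀ u v w x : V,
    ((G.dist u v + G.dist w x : ℕ) : ℝ≥0) ≤
      ((max (G.dist u w + G.dist v x) (G.dist u x + G.dist v w) : ℕ) : ℝ≥0) + 2 * δ

/-- The hyperbolicity `δ(G)`: the least `δ` for which `G` is `δ`-hyperbolic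
(`⊤` if there is none, which can happen only for infinite graphs). -/
noncomputable def hyperbolicity (G : SimpleGraph V) : ℝ≥0∞ :=
  ⨅ δ ∈ {δ : ℝ≥0 | IsHyperbolic G δ}, (δ : ℝ≥0∞)

/-- The vertices of the injective hull of `G`: the vectors of nonnegative integers `f x`, `x ∈ V`,
with `f x + f y ≥ d(x, y)` for all `x, y`, such that each `x` has some `y` with equality. -/
def HullVertex (G : SimpleGraph V) : Type _ :=
  {f : V → ℕ // (∀ x y, G.dist x y ≤ f x + f y) ∧ ∀ x, ∃ y, f x + f y = G.dist x y}

/-- The injective hull `H(G)`: two vectors are adjacent when their Chebyshev distance is `1`. -/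
def injectiveHull (G : SimpleGraph V) : SimpleGraph (HullVertex G) where
  Adj f g := (∀ x, |(f.1 x : ℤ) - g.1 x| ≤ 1) ∧ ∃ x, |(f.1 x : ℤ) - g.1 x| = 1
  symm := ⟨by
    rintro f g ⟨h, x, hx⟩
    exact ⟨fun y => by rw [abs_sub_comm]; exact h y, x, by rw [abs_sub_comm]; exact hx⟩⟩
  loopless := ⟨by
    rintro f ⟨-, x, hx⟩
    simp at hx⟩

/-- The real vertex of `H(G)` that represents the vertex `z` of `G`: its distance vector. -/
noncomputable def realVertex (G : SimpleGraph V) (hG : G.Connected) (z : V) : HullVertex G :=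
  ⟨fun x => G.dist z x,
    fun x y => by
      have h := hG.dist_triangle (u := x) (v := z) (w := y)
      rwa [G.dist_comm (u := x) (v := z)] at h,
    fun x => ⟨z, by simp [G.dist_comm (u := z) (v := x)]⟩⟩

/-- `G` is `k`-chordal: it has no induced cycle of length greater than `k`. -/
def IsKChordal (G : SimpleGraph V) (k : ℕ) : Prop :=
  ∀ n : ℕ, 3 ≤ n → k < n → IsEmpty (SimpleGraph.cycleGraph n ↪g G)

/-- `u` and `v` are connected by a path that avoids the neighborhood of `w`. -/
def ConnectedAvoiding (G : SimpleGraph V) (u v w : V) : Prop :=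
  ∃ p : G.Walk u v, p.IsPath ∧ ∀ x ∈ p.support, ¬ G.Adj w x

/-- `a`, `b`, `c` form an asteroidal triple. -/
def IsAsteroidalTriple (G : SimpleGraph V) (a b c : V) : Prop :=
  a ≠ b ∧ b ≠ c ∧ a ≠ c ∧ ¬ G.Adj a b ∧ ¬ G.Adj b c ∧ ¬ G.Adj a c ∧
    ConnectedAvoiding G a b c ∧ ConnectedAvoiding G b c a ∧ ConnectedAvoiding G a c b

/-- `G` has no asteroidal triple. -/
def IsATFree (G : SimpleGraph V) : Prop :=
  ∀ a b c : V, ¬ IsAsteroidalTriple G a b c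

end HellyGap

namespace HellyGap

variable {V : Type*} {G : SimpleGraph V}

/-! Pairwise intersecting disks have radii with `d(x,y) ≤ r x + r y`; below such an `r` lies an
extremal `f`. If `f v ≤ a`, then `d(v,x) ≤ f v + f x ≤ r x + a`, so `v` lies in all enlarged disks.
Every bound on the Helly-gap is thus a bound on the least value of extremal functions
(`isWeaklyHelly_of_hullVertex`), and `f v` is the distance in the hull from `f` to `v`.

Thinness of the hull bounds this value because `f` lies on a geodesic between real vertices, with a
real vertex in the same slice. Hyperbolicity bounds thinness and passes to the hull, since hull
geodesics extend to geodesics between real vertices.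

For `k`-chordal graphs, if `f > k / 2` everywhere, three disks of radius about `f` surround a vertex
`c`. A shortest walk through them between two separated classes of neighbors of `c` closes to an
induced cycle too short to reach the disk far from `c`, yet it has to. AT-free graphs are 5-chordal.
-/

/-! ### Extremal functions -/

/-- Below every function satisfying the triangle condition there is an extremal one. -/
theorem exists_hullVertex_le (G : SimpleGraph V) (r : V → ℕ)
    (hr : ∀ x y, G.dist x y ≤ r x + r y) : ∃ f : HullVertex G, ∀ x, f.1 x ≤ r x := by
  classical
  obtain ⟨f, hfr, hf⟩ := zorn_le_nonempty₀ (α := (V → ℕ)ᵒᵈ)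
    {f | ∀ x y, G.dist x y ≤ OrderDual.ofDual f x + OrderDual.ofDual f y} (by
      intro c hc hchain g hg
      have hne : c.Nonempty := ⟨g, hg⟩
      have key : ∀ x, ∃ f ∈ c, ∀ f' ∈ c, OrderDual.ofDual f x ≤ OrderDual.ofDual f' x := by
        intro x
        obtain ⟨f, hf, hmin⟩ := exists_minimalFor_of_wellFoundedLT (· ∈ c)
          (fun f => OrderDual.ofDual f x) hne
        exact ⟨f, hf, fun f' hf' => (le_total _ _).elim id (fun h => hmin hf' h)⟩
      choose F hFc hF using key
      -- The pointwise infimum of the chain. Of the members attaining it at `x` and at `y`, the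
      -- smaller one yields the inequality for this pair.
      refine ⟨OrderDual.toDual (fun x => OrderDual.ofDual (F x) x), ?_, ?_⟩
      · intro x y
        show G.dist x y ≤ OrderDual.ofDual (F x) x + OrderDual.ofDual (F y) y
        rcases hchain.total (hFc x) (hFc y) with h | h
        · exact (hc (hFc y) x y).trans (Nat.add_le_add_right (h x) _)
        · exact (hc (hFc x) x y).trans (Nat.add_le_add_left (h y) _)
      · intro f hf x
        exact hF x f hf) (OrderDual.toDual r) hr
  refine ⟨⟨OrderDual.ofDual f, hf.1, ?_⟩, fun x => hfr x⟩
  intro x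
  by_contra! hx
  have hlt : ∀ y, G.dist x y < OrderDual.ofDual f x + OrderDual.ofDual f y :=
    fun y => lt_of_le_of_ne (hf.1 x y) (hx y).symm
  have h0 : 0 < OrderDual.ofDual f x := by
    have := hlt x
    simp only [SimpleGraph.dist_self] at this
    omega
  -- With no equality at `x`, lowering the value there by one contradicts minimality.
  set g : V → ℕ := Function.update (OrderDual.ofDual f) x (OrderDual.ofDual f x - 1) with hgdef
  have hgx : g x = OrderDual.ofDual f x - 1 := by simp [hgdef]
  have hgy : ∀ y, y ≠ x → g y = OrderDual.ofDual f y := fun y hy => by simp [hgdef, hy]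
  have hg : ∀ y z, G.dist y z ≤ g y + g z := by
    intro y z
    by_cases hy : y = x <;> by_cases hz : z = x
    · subst hy; subst hz; simp
    · subst hy; rw [hgx, hgy z hz]; have := hlt z; omega
    · subst hz; rw [hgx, hgy y hy, G.dist_comm]; have := hlt y; omega
    · rw [hgy y hy, hgy z hz]; exact hf.1 y z
  have hle : ∀ y, g y ≤ OrderDual.ofDual f y := by
    intro y
    by_cases hy : y = x
    · subst hy; omega
    · exact (hgy y hy).le
  have h1 := hf.2 (y := OrderDual.toDual g) hg hle x
  have h2 : OrderDual.ofDual f x ≤ g x := h1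
  omega

theorem HullVertex.le_dist_add (hG : G.Connected) (f : HullVertex G) (x v : V) :
    f.1 x ≤ G.dist v x + f.1 v := by
  obtain ⟨y, hy⟩ := f.2.2 x
  have h1 := f.2.1 v y
  have h2 := hG.dist_triangle (u := x) (v := v) (w := y)
  rw [G.dist_comm (u := x) (v := v)] at h2
  omega

/-- Evaluating at a tight partner of `x` for `g` reverses the inequality, so one-sided bounds
control the Chebyshev distance. -/
theorem HullVertex.le_add_symm {f g : HullVertex G} {n : ℕ} (h : ∀ x, f.1 x ≤ g.1 x + n) (x : V) :
    g.1 x ≤ f.1 x + n := by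
  obtain ⟨y, hy⟩ := g.2.2 x
  have h1 := f.2.1 x y
  have h2 := h y
  omega

/-- A system of pairwise intersecting disks gets a common vertex after enlarging the radii by `a`,
provided that each extremal function takes a value at most `a`. -/
theorem isWeaklyHelly_of_hullVertex (hG : G.Connected) {a : ℕ}
    (h : ∀ f : HullVertex G, ∃ v, f.1 v ≤ a) : IsWeaklyHelly G a := by
  classical
  intro S r hr
  rcases S.eq_empty_or_nonempty with rfl | ⟨s, hs⟩
  · obtain ⟨v⟩ := hG.nonempty
    exact ⟨v, by simp⟩
  have hS : ∀ u ∈ S, ∀ v ∈ S, G.dist u v ≤ r u + r v := by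
    intro u hu v hv
    obtain ⟨w, hwu, hwv⟩ := hr u hu v hv
    have h1 := hG.dist_triangle (u := u) (v := w) (w := v)
    rw [G.dist_comm (u := u) (v := w)] at h1
    simp only [disk, Set.mem_ofPred_eq] at hwu hwv
    omega
  -- Off `S`, the radius is chosen so that the disk contains the one around `s`.
  obtain ⟨f, hf⟩ := exists_hullVertex_le G (fun x => if x ∈ S then r x else r s + G.dist x s) (by
    intro x y
    have h1 := hG.dist_triangle (u := x) (v := s) (w := y)
    have h2 := G.dist_comm (u := s) (v := y)
    by_cases hx : x ∈ S <;> by_cases hy : y ∈ S <;> simp only [hx, hy, if_true, if_false]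
    · exact hS x hx y hy
    · have := hS x hx s hs
      omega
    · have := hS s hs y hy
      omega
    · omega)
  obtain ⟨v, hv⟩ := h f
  refine ⟨v, Set.mem_iInter₂.2 fun x hx => ?_⟩
  have h1 := f.2.1 v x
  have h2 := hf x
  simp only [hx, if_true] at h2
  show G.dist v x ≤ r x + a
  omega

theorem hellyGap_le {a : ℕ} (h : IsWeaklyHelly G a) : hellyGap G ≤ a :=
  iInf₂_le (f := fun (a : ℕ) (_ : a ∈ {a : ℕ | IsWeaklyHelly G a}) => (a : ℕ∞)) a h

/-! ### The metric of the injective hull -/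

/-- An extremal function below `min (f + 1) (g + n)` is within one step of `f` and `n` steps of `g`.
-/
theorem exists_walk_of_le_add (n : ℕ) : ∀ f g : HullVertex G, (∀ x, f.1 x ≤ g.1 x + n) →
    ∃ p : (injectiveHull G).Walk f g, p.length ≤ n := by
  induction n with
  | zero =>
    intro f g h
    have : f = g := Subtype.ext (funext fun x =>
      le_antisymm (h x) (HullVertex.le_add_symm h x))
    subst this
    exact ⟨.nil, le_rfl⟩
  | succ n ih =>
    intro f g h
    obtain ⟨e, he⟩ := exists_hullVertex_le G (fun x => min (f.1 x + 1) (g.1 x + n)) (by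
      intro x y
      have h1 := f.2.1 x y
      have h2 := g.2.1 x y
      have h3 := h x
      have h4 := h y
      omega)
    have he1 : ∀ x, e.1 x ≤ f.1 x + 1 := fun x => (he x).trans (min_le_left _ _)
    have he2 : ∀ x, e.1 x ≤ g.1 x + n := fun x => (he x).trans (min_le_right _ _)
    obtain ⟨p, hp⟩ := ih e g he2
    by_cases hef : f = e
    · subst hef
      exact ⟨p, hp.trans n.le_succ⟩
    · have hb : ∀ x, |(f.1 x : ℤ) - e.1 x| ≤ 1 := by
        intro x
        have h1 := he1 x
        have h2 := HullVertex.le_add_symm he1 x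
        rw [abs_le]
        omega
      have hadj : (injectiveHull G).Adj f e := by
        refine ⟨hb, ?_⟩
        by_contra! hx
        refine hef (Subtype.ext (funext fun x => ?_))
        have h1 := lt_of_le_of_ne (hb x) (hx x)
        rw [Int.abs_lt_one_iff] at h1
        omega
      exact ⟨.cons hadj p, by simpa using hp⟩

theorem le_add_length {f g : HullVertex G} (p : (injectiveHull G).Walk f g) (x : V) :
    f.1 x ≤ g.1 x + p.length := by
  induction p with
  | nil => simp
  | cons h p ih =>
    have h1 := h.1 x
    rw [abs_le] at h1
    rw [SimpleGraph.Walk.length_cons]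
    omega

theorem injectiveHull_connected (hG : G.Connected) : (injectiveHull G).Connected := by
  obtain ⟨v⟩ := hG.nonempty
  have : Nonempty (HullVertex G) := ⟨realVertex G hG v⟩
  refine ⟨fun f g => ?_⟩
  obtain ⟨p, -⟩ := exists_walk_of_le_add (f.1 v + g.1 v) f g (fun x => by
    have h1 := f.le_dist_add hG x v
    have h2 := g.2.1 v x
    omega)
  exact ⟨p⟩

theorem injectiveHull_dist_le_iff (hG : G.Connected) {f g : HullVertex G} {n : ℕ} :
    (injectiveHull G).dist f g ≤ n ↔ ∀ x, f.1 x ≤ g.1 x + n := by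
  constructor
  · intro h x
    obtain ⟨p, hp⟩ := (injectiveHull_connected hG).exists_walk_length_eq_dist f g
    have := le_add_length p x
    omega
  · intro h
    obtain ⟨p, hp⟩ := exists_walk_of_le_add n f g h
    exact (SimpleGraph.dist_le p).trans hp

theorem le_add_injectiveHull_dist (hG : G.Connected) (f g : HullVertex G) (x : V) :
    f.1 x ≤ g.1 x + (injectiveHull G).dist f g :=
  (injectiveHull_dist_le_iff hG).1 le_rfl x

theorem injectiveHull_dist_realVertex (hG : G.Connected) (f : HullVertex G) (v : V) :
    (injectiveHull G).dist f (realVertex G hG v) = f.1 v := by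
  apply le_antisymm
  · rw [injectiveHull_dist_le_iff hG]
    exact fun x => f.le_dist_add hG x v
  · have := le_add_injectiveHull_dist hG f (realVertex G hG v) v
    simpa [realVertex] using this

theorem realVertex_dist_realVertex (hG : G.Connected) (u v : V) :
    (injectiveHull G).dist (realVertex G hG u) (realVertex G hG v) = G.dist u v :=
  injectiveHull_dist_realVertex hG _ v

/-- Any two extremal functions lie on a common geodesic between two real vertices. -/
theorem exists_real_geodesic (hG : G.Connected) (f g : HullVertex G) :
    ∃ x y, f.1 x + (injectiveHull G).dist f g + g.1 y = G.dist x y := by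
  -- If `g - f` stayed below the distance everywhere, the distance would be smaller by one; distance
  -- zero is separate because subtraction truncates.
  obtain ⟨x, hx⟩ : ∃ x, f.1 x + (injectiveHull G).dist f g ≤ g.1 x := by
    by_contra! h
    obtain ⟨v⟩ := hG.nonempty
    rcases Nat.eq_zero_or_pos ((injectiveHull G).dist f g) with h0 | h0
    · have h1 := h v
      have h2 := le_add_injectiveHull_dist hG f g v
      have h3 := le_add_injectiveHull_dist hG g f v
      rw [SimpleGraph.dist_comm] at h3
      omega
    · have h1 : (injectiveHull G).dist g f ≤ (injectiveHull G).dist f g - 1 := by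
        rw [injectiveHull_dist_le_iff hG]
        intro x
        have := h x
        omega
      rw [SimpleGraph.dist_comm] at h1
      omega
  obtain ⟨y, hy⟩ := g.2.2 x
  refine ⟨x, y, ?_⟩
  have h2 := le_add_injectiveHull_dist hG g f x
  rw [SimpleGraph.dist_comm] at h2
  omega

/-! ### Geodesics, thinness and hyperbolicity -/

theorem exists_dist_eq_of_le (hG : G.Connected) (x y : V) {l : ℕ} (hl : l ≤ G.dist x y) :
    ∃ c, G.dist x c = l ∧ l + G.dist c y = G.dist x y := by
  obtain ⟨p, hp⟩ := hG.exists_walk_length_eq_dist x y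
  have h1 := SimpleGraph.dist_le (p.take l)
  have h2 := SimpleGraph.dist_le (p.drop l)
  rw [SimpleGraph.Walk.take_length] at h1
  rw [SimpleGraph.Walk.drop_length] at h2
  have h3 := hG.dist_triangle (u := x) (v := p.getVert l) (w := y)
  exact ⟨p.getVert l, by omega, by omega⟩

/-- If `y` is a tight partner of `s`, then `h` lies on a hull geodesic from `s` to `y`, in the same
slice as the vertex at distance `h s` on a geodesic of `G`. -/
theorem HullVertex.exists_le_of_isThinInterval (hG : G.Connected) {t : ℕ}
    (ht : ∀ f g, IsThinInterval (injectiveHull G) f g t) (h : HullVertex G) :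
    ∃ v, h.1 v ≤ t := by
  obtain ⟨s⟩ := hG.nonempty
  obtain ⟨y, hy⟩ := h.2.2 s
  obtain ⟨c, hc, hcy⟩ := exists_dist_eq_of_le hG s y (l := h.1 s) (by omega)
  refine ⟨c, ?_⟩
  have hsy := realVertex_dist_realVertex hG s y
  have hsh := injectiveHull_dist_realVertex hG h s
  rw [SimpleGraph.dist_comm] at hsh
  have hhy := injectiveHull_dist_realVertex hG h y
  have hsc := realVertex_dist_realVertex hG s c
  have hcy' := realVertex_dist_realVertex hG c y
  rw [← injectiveHull_dist_realVertex hG h c]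
  refine ht (realVertex G hG s) (realVertex G hG y) (h.1 s) (by omega) h ⟨?_, hsh⟩
    (realVertex G hG c) ⟨?_, by omega⟩
  · show _ + _ = _
    omega
  · show _ + _ = _
    omega

/-- For `u`, `v` in one slice, both cross sums equal `d(x,y)`, leaving `d(u,v) ≤ 2δ`. -/
theorem IsHyperbolic.isThinInterval {δ : ℝ≥0} (h : IsHyperbolic G δ) (x y : V) :
    IsThinInterval G x y ⌊2 * δ⌋₊ := by
  rintro l - u ⟨hu, hul⟩ v ⟨hv, hvl⟩
  have h1 := h u v x y
  simp only [interval, Set.mem_ofPred_eq] at hu hv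
  have e1 : G.dist u x + G.dist v y = G.dist x y := by rw [G.dist_comm (u := u)]; omega
  have e2 : G.dist u y + G.dist v x = G.dist x y := by rw [G.dist_comm (u := v)]; omega
  rw [e1, e2, max_self, Nat.cast_add, add_comm, add_le_add_iff_left] at h1
  exact Nat.le_floor h1

theorem intervalThinness_le {t : ℕ} (h : ∀ x y, IsThinInterval G x y t) :
    intervalThinness G ≤ t :=
  iInf₂_le (f := fun (t : ℕ) (_ : t ∈ {t : ℕ | ∀ x y, IsThinInterval G x y t}) => (t : ℕ∞)) t h

theorem toENNReal_le_two_mul_of_le_floor {n : ℕ∞} {δ : ℝ≥0} (h : n ≤ (⌊2 * δ⌋₊ : ℕ∞)) :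
    (n : ℝ≥0∞) ≤ 2 * (δ : ℝ≥0∞) := by
  calc (n : ℝ≥0∞) ≤ ((⌊2 * δ⌋₊ : ℕ∞) : ℝ≥0∞) := ENat.toENNReal_le.2 h
    _ = ((⌊2 * δ⌋₊ : ℝ≥0) : ℝ≥0∞) := by simp
    _ ≤ ((2 * δ : ℝ≥0) : ℝ≥0∞) := ENNReal.coe_le_coe.2 (Nat.floor_le zero_le)
    _ = 2 * (δ : ℝ≥0∞) := by simp

theorem le_two_mul_hyperbolicity {b : ℝ≥0∞}
    (h : ∀ δ : ℝ≥0, IsHyperbolic G δ → b ≤ 2 * (δ : ℝ≥0∞)) : b ≤ 2 * hyperbolicity G := by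
  rw [mul_comm, ← ENNReal.div_le_iff (by simp) (by simp)]
  refine le_iInf₂ fun δ hδ => ?_
  rw [ENNReal.div_le_iff (by simp) (by simp), mul_comm]
  exact h δ hδ

theorem intervalThinness_le_two_mul_hyperbolicity (G : SimpleGraph V) :
    (intervalThinness G : ℝ≥0∞) ≤ 2 * hyperbolicity G :=
  le_two_mul_hyperbolicity fun _ h =>
    toENNReal_le_two_mul_of_le_floor (intervalThinness_le h.isThinInterval)

/-- Extending both geodesics to real endpoints raises the first sum by exactly the total length of
the tails, and the other two by at most that. -/
theorem isHyperbolic_injectiveHull_iff (hG : G.Connected) {δ : ℝ≥0} :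
    IsHyperbolic (injectiveHull G) δ ↔ IsHyperbolic G δ := by
  constructor
  · intro h u v w x
    have := h (realVertex G hG u) (realVertex G hG v) (realVertex G hG w) (realVertex G hG x)
    simpa only [realVertex_dist_realVertex] using this
  · intro h f g e k
    obtain ⟨x, y, hxy⟩ := exists_real_geodesic hG f g
    obtain ⟨z, w, hzw⟩ := exists_real_geodesic hG e k
    have h0 := h x y z w
    have key : ∀ (a b : HullVertex G) (p q : V),
        G.dist p q ≤ a.1 p + (injectiveHull G).dist a b + b.1 q := by
      intro a b p q
      have h1 := a.2.1 p q
      have h2 := le_add_injectiveHull_dist hG a b q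
      omega
    have hle : max (G.dist x z + G.dist y w) (G.dist x w + G.dist y z) ≤
        max ((injectiveHull G).dist f e + (injectiveHull G).dist g k)
          ((injectiveHull G).dist f k + (injectiveHull G).dist g e) +
        (f.1 x + g.1 y + e.1 z + k.1 w) := by
      have h1 := key f e x z
      have h2 := key g k y w
      have h3 := key f k x w
      have h4 := key g e y z
      omega
    have heq : G.dist x y + G.dist z w = ((injectiveHull G).dist f g +
        (injectiveHull G).dist e k) + (f.1 x + g.1 y + e.1 z + k.1 w) := by omega
    refine le_of_add_le_add_right (a := ((f.1 x + g.1 y + e.1 z + k.1 w : ℕ) : ℝ≥0)) ?_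
    rw [← Nat.cast_add, ← heq, add_right_comm, ← Nat.cast_add]
    exact h0.trans (add_le_add_left (Nat.cast_le.2 hle) _)

theorem hyperbolicity_injectiveHull (hG : G.Connected) :
    hyperbolicity (injectiveHull G) = hyperbolicity G := by
  simp only [hyperbolicity, isHyperbolic_injectiveHull_iff hG]

theorem IsHyperbolic.isWeaklyHelly (hG : G.Connected) {δ : ℝ≥0} (h : IsHyperbolic G δ) :
    IsWeaklyHelly G ⌊2 * δ⌋₊ :=
  isWeaklyHelly_of_hullVertex hG <| HullVertex.exists_le_of_isThinInterval hG
    ((isHyperbolic_injectiveHull_iff hG).2 h).isThinInterval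

theorem le_intervalThinness {n : ℕ∞}
    (h : ∀ t : ℕ, (∀ x y, IsThinInterval G x y t) → n ≤ t) : n ≤ intervalThinness G :=
  le_iInf₂ h

theorem exists_nat_intervalThinness (h : intervalThinness G ≠ ⊤) :
    ∃ t : ℕ, intervalThinness G = t ∧ ∀ x y, IsThinInterval G x y t := by
  obtain ⟨t, ht⟩ := ENat.ne_top_iff_exists.1 h
  refine ⟨t, ht.symm, ?_⟩
  by_contra hn
  have : ((t + 1 : ℕ) : ℕ∞) ≤ intervalThinness G := le_intervalThinness fun s hs => by
    refine Nat.cast_le.2 (Nat.succ_le_of_lt (lt_of_not_ge fun hst => hn fun x y l hl u hu v hv => ?_))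
    exact (hs x y l hl u hu v hv).trans hst
  rw [← ht, Nat.cast_le] at this
  omega

/-! ### Chordless cycles -/

theorem exists_walk_of_adj_succ {v : ℕ → V} {i : ℕ} (n : ℕ)
    (hv : ∀ t, i ≤ t → t < i + n → G.Adj (v t) (v (t + 1))) :
    ∃ p : G.Walk (v i) (v (i + n)), p.length = n ∧
      ∀ x ∈ p.support, ∃ t, i ≤ t ∧ t ≤ i + n ∧ x = v t := by
  induction n with
  | zero => exact ⟨.nil, rfl, fun x hx => ⟨i, le_rfl, le_rfl, by simpa using hx⟩⟩
  | succ n ih =>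
    obtain ⟨p, hp, hs⟩ := ih fun t h1 h2 => hv t h1 (by omega)
    refine ⟨p.concat (hv (i + n) (by omega) (by omega)), by simp [hp], fun x hx => ?_⟩
    rw [SimpleGraph.Walk.support_concat, List.mem_append,
      List.mem_singleton] at hx
    rcases hx with hx | rfl
    · obtain ⟨t, h1, h2, h3⟩ := hs x hx
      exact ⟨t, h1, by omega, h3⟩
    · exact ⟨i + n + 1, by omega, by omega, rfl⟩

theorem cycleGraph_adj_iff_of_lt {n : ℕ} {i j : Fin (n + 2)} (hij : i < j) :
    (SimpleGraph.cycleGraph (n + 2)).Adj i j ↔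
      j.val = i.val + 1 ∨ (i.val = 0 ∧ j.val = n + 1) := by
  have hi := i.2
  have hj := j.2
  have hlt : i.val < j.val := hij
  have h1 : (j - i).val = j.val - i.val := Fin.sub_val_of_le hij.le
  have h2 : (i - j).val = n + 2 - (j.val - i.val) := by
    rw [Fin.val_sub, Nat.mod_eq_of_lt (by omega)]
    omega
  rw [SimpleGraph.cycleGraph_adj', h1, h2]
  omega

/-- `v 0, …, v m` is a walk inside `W` that starts in `A` and ends in `B`. -/
def JoinsIn (G : SimpleGraph V) (W A B : Set V) (m : ℕ) (v : ℕ → V) : Prop :=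
  v 0 ∈ A ∧ v m ∈ B ∧ (∀ i ≤ m, v i ∈ W) ∧ ∀ i < m, G.Adj (v i) (v (i + 1))

/-- If the neighbors of `c` in a set `W` that avoids `c` are divided into two classes that some
walk in `W` joins, then a shortest such walk closes up with `c` to an induced cycle. -/
theorem exists_induced_cycle {c : V} {W A B : Set V} (hcW : c ∉ W)
    (hN : ∀ w ∈ W, G.Adj c w → w ∈ A ∨ w ∈ B) (hA : ∀ a ∈ A, G.Adj c a)
    (hB : ∀ b ∈ B, G.Adj c b) (hAB : ∀ x ∈ A, x ∉ B) (hex : ∃ m v, JoinsIn G W A B m v) :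
    ∃ m v, 1 ≤ m ∧ JoinsIn G W A B m v ∧ Nonempty (SimpleGraph.cycleGraph (m + 2) ↪g G) := by
  classical
  obtain ⟨v, hv⟩ := Nat.find_spec hex
  have hmin : ∀ m' < Nat.find hex, ∀ v', ¬ JoinsIn G W A B m' v' :=
    fun m' h v' hv' => Nat.find_min hex h ⟨v', hv'⟩
  generalize Nat.find hex = m at hv hmin
  obtain ⟨h0, hm, hW, hadj⟩ := hv
  have hm1 : 1 ≤ m := by
    rcases Nat.eq_zero_or_pos m with rfl | h
    · exact absurd hm (hAB _ h0)
    · exact h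
  -- An interior neighbor of `c` lies in `A` or `B`, so a proper part of the walk would already join
  -- them.
  have hinner : ∀ i, 0 < i → i < m → ¬ G.Adj c (v i) := by
    intro i hi him hc
    rcases hN _ (hW i him.le) hc with h | h
    · refine hmin (m - i) (by omega) (fun t => v (t + i)) ⟨by simpa using h, ?_, ?_, ?_⟩
      · simpa [Nat.sub_add_cancel him.le] using hm
      · exact fun t ht => hW _ (by omega)
      · intro t ht
        have := hadj (t + i) (by omega)
        rwa [add_right_comm] at this
    · exact hmin i him v ⟨h0, h, fun t ht => hW t (by omega), fun t ht => hadj t (by omega)⟩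
  -- A chord would bypass `d` vertices.
  have hshort : ∀ i j d, i + d + 1 = j → j ≤ m → 0 < d → ¬ G.Adj (v i) (v j) := by
    intro i j d hd hj hpos h
    refine hmin (m - d) (by omega) (fun t => if t ≤ i then v t else v (t + d)) ⟨?_, ?_, ?_, ?_⟩
    · simpa using h0
    · have : ¬ m - d ≤ i := by omega
      simpa [this, Nat.sub_add_cancel (show d ≤ m by omega)] using hm
    · intro t ht
      dsimp only
      split_ifs <;> exact hW _ (by omega)
    · intro t ht
      rcases lt_trichotomy t i with hti | rfl | hti
      · simp only [show t ≤ i by omega, show t + 1 ≤ i by omega, if_true]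
        exact hadj t (by omega)
      · simp only [le_refl, show ¬ t + 1 ≤ t by omega, if_true, if_false]
        rwa [show t + 1 + d = j by omega]
      · simp only [show ¬ t ≤ i by omega, show ¬ t + 1 ≤ i by omega, if_false]
        have := hadj (t + d) (by omega)
        rwa [add_right_comm] at this
  -- A repeated vertex gives a chord to `v (j + 1)` or, when `j = m`, a forbidden membership or
  -- adjacency to `c`.
  have hne : ∀ i j, i < j → j ≤ m → v i ≠ v j := by
    intro i j hij hj h
    rcases Nat.lt_or_ge j m with hjm | hjm
    · exact hshort i (j + 1) (j - i) (by omega) (by omega) (by omega) (h ▸ hadj j hjm)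
    · obtain rfl : j = m := by omega
      rcases Nat.eq_zero_or_pos i with rfl | hi
      · exact hAB _ h0 (h ▸ hm)
      · exact hinner i hi hij (h ▸ hB _ hm)
  refine ⟨m, v, hm1, ⟨h0, hm, hW, hadj⟩, ⟨?_⟩⟩
  let φ : Fin (m + 2) → V := fun i => if i.val ≤ m then v i.val else c
  have hcv : ∀ i ≤ m, v i ≠ c := fun i hi h => hcW (h ▸ hW i hi)
  have hφ : ∀ i j : Fin (m + 2), i < j →
      φ i ≠ φ j ∧ (G.Adj (φ i) (φ j) ↔ (SimpleGraph.cycleGraph (m + 2)).Adj i j) := by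
    intro i j hij
    have hlt : i.val < j.val := hij
    have hj2 := j.2
    have hi : i.val ≤ m := by omega
    rw [cycleGraph_adj_iff_of_lt hij]
    by_cases hj : j.val ≤ m
    · simp only [φ, hi, hj, if_true]
      refine ⟨hne _ _ hlt hj, fun h => ?_, fun h => ?_⟩
      · by_contra hcon
        exact hshort i.val j.val (j.val - i.val - 1) (by omega) hj (by omega) h
      · rcases h with h | h
        · rw [h]; exact hadj _ (by omega)
        · omega
    · simp only [φ, hi, hj, if_true, if_false]
      refine ⟨hcv _ hi, fun h => ?_, fun h => ?_⟩
      · by_contra hcon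
        exact hinner i.val (by omega) (by omega) h.symm
      · rcases h with h | h
        · rw [show i.val = m by omega]; exact (hB _ hm).symm
        · rw [h.1]; exact (hA _ h0).symm
  refine ⟨⟨φ, fun i j h => ?_⟩, fun {i j} => ?_⟩
  · rcases lt_trichotomy i j with hij | rfl | hij
    · exact absurd h (hφ i j hij).1
    · rfl
    · exact absurd h.symm (hφ j i hij).1
  · show G.Adj (φ i) (φ j) ↔ _
    rcases lt_trichotomy i j with hij | rfl | hij
    · exact (hφ i j hij).2
    · simp
    · rw [G.adj_comm, (hφ j i hij).2, SimpleGraph.adj_comm]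

/-- The two ways round from `c` to `v i` have total length `m + 2`. -/
theorem JoinsIn.dist_le {W A B : Set V} {m : ℕ} {v : ℕ → V} (h : JoinsIn G W A B m v) {c : V}
    (hG : G.Connected) (hA : ∀ a ∈ A, G.Adj c a) (hB : ∀ b ∈ B, G.Adj c b) {i : ℕ} (hi : i ≤ m) :
    G.dist c (v i) ≤ (m + 2) / 2 := by
  obtain ⟨h0, hm, -, hadj⟩ := h
  obtain ⟨p, hp, -⟩ := exists_walk_of_adj_succ (G := G) (v := v) (i := 0) i
    fun t _ ht => hadj t (by omega)
  obtain ⟨q, hq, -⟩ := exists_walk_of_adj_succ (G := G) (v := v) (i := i) (m - i)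
    fun t _ ht => hadj t (by omega)
  have h1 := SimpleGraph.dist_le p
  have h2 := SimpleGraph.dist_le q
  rw [hp, zero_add] at h1
  rw [hq, Nat.add_sub_cancel' hi] at h2
  have h3 := hG.dist_triangle (u := c) (v := v 0) (w := v i)
  have h4 := hG.dist_triangle (u := c) (v := v m) (w := v i)
  rw [SimpleGraph.dist_eq_one_iff_adj.2 (hA _ h0)] at h3
  rw [SimpleGraph.dist_eq_one_iff_adj.2 (hB _ hm), G.dist_comm (u := v m)] at h4
  omega

theorem joinsIn_of_walk {W A B : Set V} {a b : V} (ha : a ∈ A) (hb : b ∈ B) (p : G.Walk a b)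
    (hp : ∀ x ∈ p.support, x ∈ W) : JoinsIn G W A B p.length p.getVert :=
  ⟨by simpa using ha, by simpa using hb, fun i _ => hp _ (p.getVert_mem_support i),
    fun _ hi => p.adj_getVert_succ hi⟩

theorem exists_walk_in_disk (hG : G.Connected) {u v : V} {r : ℕ} (hu : u ∈ disk G v r) :
    ∃ p : G.Walk u v, ∀ x ∈ p.support, x ∈ disk G v r := by
  classical
  obtain ⟨p, hp⟩ := hG.exists_walk_length_eq_dist u v
  refine ⟨p, fun x hx => ?_⟩
  have h1 := SimpleGraph.dist_le (p.dropUntil x hx)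
  have h2 := p.length_dropUntil_le_length hx
  have h3 : G.dist u v ≤ r := hu
  show G.dist x v ≤ r
  omega

/-- If `d(x, z) ≤ r + q + 1`, then the disks `D(x, r)` and `D(z, q)` intersect or are joined by
an edge, so that their centers are connected inside their union. -/
theorem exists_walk_union_disk (hG : G.Connected) {x z : V} {r q : ℕ}
    (h : G.dist x z ≤ r + q + 1) :
    ∃ p : G.Walk x z, ∀ w ∈ p.support, w ∈ disk G x r ∪ disk G z q := by
  classical
  obtain ⟨p, hp⟩ := hG.exists_walk_length_eq_dist x z
  refine ⟨p, fun w hw => ?_⟩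
  have h1 := SimpleGraph.dist_le (p.dropUntil w hw)
  have h2 := SimpleGraph.dist_le (p.takeUntil w hw)
  have h3 := congrArg SimpleGraph.Walk.length (p.take_spec hw)
  rw [SimpleGraph.Walk.length_append] at h3
  rw [G.dist_comm] at h2
  show G.dist w x ≤ r ∨ G.dist w z ≤ q
  omega

/-- In a `k`-chordal graph every extremal function has a value at most `k / 2`. -/
theorem IsKChordal.exists_hullVertex_le (hG : G.Connected) {k : ℕ} (hk : IsKChordal G k)
    (f : HullVertex G) : ∃ v, f.1 v ≤ k / 2 := by
  by_contra! hbig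
  have hle : ∀ n, 3 ≤ n → Nonempty (SimpleGraph.cycleGraph n ↪g G) → n ≤ k := by
    intro n hn ⟨e⟩
    by_contra! hkn
    exact (hk n hn hkn).false e
  obtain ⟨s⟩ := hG.nonempty
  obtain ⟨y, hy⟩ := f.2.2 s
  have hs0 := hbig s
  have hy0 := hbig y
  -- `a`, `c`, `b` are consecutive on a geodesic from `s` to `y`, with `c` at distance `f s` from
  -- `s`.
  obtain ⟨a, hsa, hay⟩ := exists_dist_eq_of_le hG s y (l := f.1 s - 1) (by omega)
  obtain ⟨c, hac, hcy⟩ := exists_dist_eq_of_le hG a y (l := 1) (by omega)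
  obtain ⟨b, hcb, hby⟩ := exists_dist_eq_of_le hG c y (l := 1) (by omega)
  rw [SimpleGraph.dist_eq_one_iff_adj] at hac hcb
  obtain ⟨z, hz⟩ := f.2.2 c
  -- Radii one less than `f` put `P` and `Q` at distance at least 2, while each still meets `D` or
  -- is joined to it by an edge.
  have hc0 := hbig c
  set P := disk G s (f.1 s - 1) with hP
  set Q := disk G y (f.1 y - 1) with hQ
  set D := disk G z (f.1 z) with hD
  have hPQ : ∀ u ∈ P, ∀ w ∈ Q, 2 ≤ G.dist u w := by
    intro u hu w hw
    have hu' : G.dist u s ≤ f.1 s - 1 := hu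
    have hw' : G.dist w y ≤ f.1 y - 1 := hw
    have h1 := hG.dist_triangle (u := s) (v := u) (w := y)
    have h2 := hG.dist_triangle (u := u) (v := w) (w := y)
    rw [G.dist_comm] at hu'
    omega
  have hcD : ∀ w ∈ D, k / 2 < G.dist c w := by
    intro w hw
    have hw' : G.dist w z ≤ f.1 z := hw
    have h1 := hG.dist_triangle (u := c) (v := w) (w := z)
    omega
  have haP : a ∈ P := by
    show G.dist a s ≤ _
    rw [G.dist_comm, hsa]
  have hbQ : b ∈ Q := by
    show G.dist b y ≤ _
    omega
  have hcW : c ∉ P ∪ D ∪ Q := by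
    rintro ((h | h) | h)
    · have := hPQ c h b hbQ
      rw [SimpleGraph.dist_eq_one_iff_adj.2 hcb] at this
      omega
    · have := hcD c h
      simp at this
    · have := hPQ a haP c h
      rw [SimpleGraph.dist_eq_one_iff_adj.2 hac] at this
      omega
  have hwalk : ∃ p : G.Walk a b, ∀ x ∈ p.support, x ∈ P ∪ D ∪ Q := by
    obtain ⟨p₁, hp₁⟩ := exists_walk_in_disk hG haP
    obtain ⟨p₂, hp₂⟩ := exists_walk_union_disk hG (x := s) (z := z) (r := f.1 s - 1) (q := f.1 z)
      (by have := f.2.1 s z; omega)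
    obtain ⟨p₃, hp₃⟩ := exists_walk_union_disk hG (x := y) (z := z) (r := f.1 y - 1) (q := f.1 z)
      (by have := f.2.1 y z; omega)
    obtain ⟨p₄, hp₄⟩ := exists_walk_in_disk hG hbQ
    refine ⟨((p₁.append p₂).append p₃.reverse).append p₄.reverse, fun x hx => ?_⟩
    simp only [SimpleGraph.Walk.mem_support_append_iff, SimpleGraph.Walk.support_reverse,
      List.mem_reverse] at hx
    rcases hx with ((hx | hx) | hx) | hx
    · exact Or.inl (Or.inl (hp₁ x hx))
    · exact Or.inl (hp₂ x hx)
    · exact (hp₃ x hx).elim Or.inr fun h => Or.inl (Or.inr h)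
    · exact Or.inr (hp₄ x hx)
  obtain ⟨p, hp⟩ := hwalk
  have hab : b ≠ a := by
    rintro rfl
    simpa using hPQ b haP b hbQ
  -- This cycle only serves to give `3 ≤ k`, so that no neighbor of `c` lies in `D`.
  obtain ⟨m₀, -, hm₀, -, hcyc₀⟩ := exists_induced_cycle (G := G) (A := {a})
    (B := {w | w ≠ a ∧ G.Adj c w}) hcW
    (fun w _ hw => (em (w = a)).imp id fun h => ⟨h, hw⟩) (by rintro _ rfl; exact hac.symm)
    (fun _ h => h.2) (fun _ h h' => h'.1 h)
    ⟨_, _, joinsIn_of_walk (Set.mem_singleton a) (Set.mem_ofPred.2 ⟨hab, hcb⟩) p hp⟩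
  have hk3 := hle _ (by omega) hcyc₀
  have hNA : ∀ w ∈ P ∩ {w | G.Adj c w}, G.Adj c w := fun _ h => h.2
  have hNB : ∀ w ∈ Q ∩ {w | G.Adj c w}, G.Adj c w := fun _ h => h.2
  obtain ⟨m, v, hm, hv, hcyc⟩ := exists_induced_cycle (G := G)
    (A := P ∩ {w | G.Adj c w}) (B := Q ∩ {w | G.Adj c w}) hcW (by
      rintro w ((hw | hw) | hw) hcw
      · exact Or.inl ⟨hw, hcw⟩
      · have := hcD w hw
        rw [SimpleGraph.dist_eq_one_iff_adj.2 hcw] at this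
        omega
      · exact Or.inr ⟨hw, hcw⟩) hNA hNB
    (fun x hx hx' => by simpa using hPQ x hx.1 x hx'.1)
    ⟨_, _, joinsIn_of_walk (Set.mem_inter haP hac.symm) (Set.mem_inter hbQ hcb) p hp⟩
  have hkm := hle _ (by omega) hcyc
  -- Since `m + 2 ≤ k`, the cycle stays within `k / 2` of `c`.
  have hvD : ∀ i ≤ m, v i ∉ D := by
    intro i hi h
    have h1 := hcD _ h
    have h2 := hv.dist_le hG hNA hNB hi
    omega
  -- Without `D`, the walk cannot leave `P`, as no edge joins `P` to `Q`.
  have hvP : ∀ i ≤ m, v i ∈ P := by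
    intro i
    induction i with
    | zero => exact fun _ => hv.1.1
    | succ i ih =>
      intro hi
      rcases hv.2.2.1 (i + 1) hi with (h | h) | h
      · exact h
      · exact absurd h (hvD _ hi)
      · have h1 := hPQ _ (ih (by omega)) _ h
        rw [SimpleGraph.dist_eq_one_iff_adj.2 (hv.2.2.2 i (by omega))] at h1
        omega
  simpa using hPQ _ (hvP m le_rfl) _ hv.2.1.1

theorem IsKChordal.hellyGap_le (hG : G.Connected) {k : ℕ} (hk : IsKChordal G k) :
    hellyGap G ≤ ((k / 2 : ℕ) : ℕ∞) :=
  HellyGap.hellyGap_le (isWeaklyHelly_of_hullVertex hG (hk.exists_hullVertex_le hG))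

/-! ### Asteroidal triples -/

theorem connectedAvoiding_of_walk {u v w : V} (p : G.Walk u v)
    (hp : ∀ x ∈ p.support, ¬ G.Adj w x) : ConnectedAvoiding G u v w := by
  classical
  exact ⟨p.bypass, p.bypass_isPath, fun x hx => hp x (p.support_bypass_subset_support hx)⟩

/-- On an induced cycle of length at least 6, vertices 0, 2, 4 form an asteroidal triple: the arc
between two of them avoids the neighbors of the third. -/
theorem IsATFree.isKChordal (h : IsATFree G) : IsKChordal G 5 := by
  intro n hn3 hn
  refine ⟨fun e => ?_⟩
  obtain ⟨n, rfl⟩ : ∃ n', n = n' + 2 := ⟨n - 2, by omega⟩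
  let v : ℕ → V := fun t => e (Fin.ofNat (n + 2) t)
  have hval : ∀ t, t < n + 2 → (Fin.ofNat (n + 2) t).val = t := fun t ht => Nat.mod_eq_of_lt ht
  have hadj : ∀ s t, s < t → t < n + 2 → (G.Adj (v s) (v t) ↔ t = s + 1 ∨ (s = 0 ∧ t = n + 1)) := by
    intro s t hst ht
    have hlt : Fin.ofNat (n + 2) s < Fin.ofNat (n + 2) t := by
      rw [Fin.lt_def, hval s (by omega), hval t ht]
      exact hst
    show G.Adj (e _) (e _) ↔ _
    rw [e.map_adj_iff, cycleGraph_adj_iff_of_lt hlt, hval s (by omega), hval t ht]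
  have hne : ∀ s t, s < t → t < n + 2 → v s ≠ v t := by
    intro s t hst ht hcon
    have := congrArg Fin.val (e.injective hcon)
    rw [hval s (by omega), hval t ht] at this
    omega
  have hwalk : ∀ i d, i + d < n + 2 → ∃ p : G.Walk (v i) (v (i + d)), p.length = d ∧
      ∀ x ∈ p.support, ∃ t, i ≤ t ∧ t ≤ i + d ∧ x = v t := fun i d hd =>
    exists_walk_of_adj_succ d fun t h1 h2 => (hadj t (t + 1) (by omega) (by omega)).2 (Or.inl rfl)
  refine h (v 0) (v 2) (v 4) ⟨hne _ _ (by omega) (by omega), hne _ _ (by omega) (by omega),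
    hne _ _ (by omega) (by omega), ?_, ?_, ?_, ?_, ?_, ?_⟩
  · rw [hadj _ _ (by omega) (by omega)]; omega
  · rw [hadj _ _ (by omega) (by omega)]; omega
  · rw [hadj _ _ (by omega) (by omega)]; omega
  · obtain ⟨p, -, hp⟩ := hwalk 0 2 (by omega)
    refine connectedAvoiding_of_walk p fun x hx => ?_
    obtain ⟨t, h1, h2, rfl⟩ := hp x hx
    rw [G.adj_comm, hadj _ _ (by omega) (by omega)]
    omega
  · obtain ⟨p, -, hp⟩ := hwalk 2 2 (by omega)
    refine connectedAvoiding_of_walk p fun x hx => ?_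
    obtain ⟨t, h1, h2, rfl⟩ := hp x hx
    rw [hadj _ _ (by omega) (by omega)]
    omega
  -- The arc from 4 to the last vertex `n + 1`, which is adjacent to 0.
  · obtain ⟨p, -, hp⟩ := hwalk 4 (n - 3) (by omega)
    have hlast : G.Adj (v 0) (v (4 + (n - 3))) := by
      rw [hadj _ _ (by omega) (by omega)]
      omega
    refine connectedAvoiding_of_walk (p.reverse.cons hlast) fun x hx => ?_
    rw [SimpleGraph.Walk.support_cons, List.mem_cons, SimpleGraph.Walk.support_reverse,
      List.mem_reverse] at hx
    rcases hx with rfl | hx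
    · rw [G.adj_comm, hadj _ _ (by omega) (by omega)]
      omega
    · obtain ⟨t, h1, h2, rfl⟩ := hp x hx
      rw [hadj _ _ (by omega) (by omega)]
      omega

end HellyGap

theorem mainTheorem12 {V : Type*} (G : SimpleGraph V) (hG : G.Connected) :
    (HellyGap.injectiveHull G).Connected ∧
    (∀ h : HellyGap.HullVertex G, ∃ v : V,
      ((HellyGap.injectiveHull G).dist h (HellyGap.realVertex G hG v) : ℕ∞) ≤
        HellyGap.intervalThinness (HellyGap.injectiveHull G)) ∧
    HellyGap.hellyGap G ≤ HellyGap.intervalThinness (HellyGap.injectiveHull G) ∧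
    (HellyGap.intervalThinness G : ℝ≥0∞) ≤ 2 * HellyGap.hyperbolicity G ∧
    (HellyGap.intervalThinness (HellyGap.injectiveHull G) : ℝ≥0∞) ≤
      2 * HellyGap.hyperbolicity (HellyGap.injectiveHull G) ∧
    HellyGap.hyperbolicity (HellyGap.injectiveHull G) = HellyGap.hyperbolicity G ∧
    (HellyGap.hellyGap G : ℝ≥0∞) ≤ 2 * HellyGap.hyperbolicity G ∧
    (∀ δ : ℝ≥0, HellyGap.IsHyperbolic G δ →
      HellyGap.IsWeaklyHelly G ⌊2 * δ⌋₊ ∧ (HellyGap.hellyGap G : ℝ≥0∞) ≤ 2 * (δ : ℝ≥0∞)) ∧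
    (∀ k : ℕ, HellyGap.IsKChordal G k → HellyGap.hellyGap G ≤ ((k / 2 : ℕ) : ℕ∞)) ∧
    (HellyGap.IsATFree G → HellyGap.hellyGap G ≤ 2) := by
  open HellyGap in
  have hyp : ∀ δ : ℝ≥0, IsHyperbolic G δ → (hellyGap G : ℝ≥0∞) ≤ 2 * (δ : ℝ≥0∞) := fun δ h =>
    toENNReal_le_two_mul_of_le_floor (hellyGap_le (h.isWeaklyHelly hG))
  open HellyGap in
  refine ⟨injectiveHull_connected hG, fun h => ?_, ?_, intervalThinness_le_two_mul_hyperbolicity G,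
    intervalThinness_le_two_mul_hyperbolicity _, hyperbolicity_injectiveHull hG,
    le_two_mul_hyperbolicity hyp, fun δ h => ⟨h.isWeaklyHelly hG, hyp δ h⟩,
    fun k hk => hk.hellyGap_le hG, fun h => by simpa using h.isKChordal.hellyGap_le hG⟩
  · by_cases htop : intervalThinness (injectiveHull G) = ⊤
    · obtain ⟨v⟩ := hG.nonempty
      exact ⟨v, htop ▸ le_top⟩
    · obtain ⟨t, ht, hthin⟩ := exists_nat_intervalThinness htop
      obtain ⟨v, hv⟩ := h.exists_le_of_isThinInterval hG hthin
      refine ⟨v, ?_⟩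
      rw [ht, injectiveHull_dist_realVertex hG h v]
      exact Nat.cast_le.2 hv
  · exact le_intervalThinness fun t ht => hellyGap_le
      (isWeaklyHelly_of_hullVertex hG (HullVertex.exists_le_of_isThinInterval hG ht))
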